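/- There is an absolute constant $\varepsilon_0>0$ such that for every $0<\varepsilon<\varepsilon_0$ the following holds, with $\eta=\varepsilon^9$. Let $\frac16<\rho<\frac15$, let $N\ge 1$ and $Y$ be real numbers, and put $L_1=2N^{\rho-\varepsilon/2}$ and $L=N^{\rho-\varepsilon/3}$. Let $g(x)=\frac aq x^2+\beta x+\gamma$, where $\beta,\gamma\in\mathbb R$ and $\frac aq$ is a fraction in lowest terms with $q\ge1$ and $L_1^{1/2}N\ll q\ll L_1^{1/2}N$. Suppose that $N^{\rho}\ll Y\ll N^{1-4\rho}$. For each integer $y$ with $Y<y\le 2Y$ let $I(y)$ be an arbitrary subinterval of $\left(\frac N{2y},\frac Ny\right]$, and let $c_\ell,a_x,b_y$ be complex numbers with $|c_\ell|\le1$, $|a_x|\le1$, $|b_y|\le1$. Then, writing $e(\theta)=e^{2\pi i\theta}$, $$\sum_{1\le \ell\le L}c_\ell\sum_{Y<y\le 2Y}b_y\sum_{x\in I(y)}a_x\,e(\ell g(xy))\ll N^{1-10\eta},$$ where $\ell,y,x$ run over integers and the implied constant depends only on $\varepsilon$ and on the implied constants in the hypotheses on $q$ and $Y$. -/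

import Mathlib

namespace TypeII

open Classical in
/-- The natural numbers `n` with `1 ≤ n ≤ t` and `n ∈ J`, for a set `J` of real numbers. -/
noncomputable def natsUpTo (t : ℝ) (J : Set ℝ) : Finset ℕ :=
  (Finset.Icc 1 ⌊t⌋₊).filter fun n => (n : ℝ) ∈ J

/-- The natural numbers `y ∼ Y`, that is, `Y < y ≤ 2 Y`. -/
noncomputable def dyadic (Y : ℝ) : Finset ℕ :=
  Finset.Ioc ⌊Y⌋₊ ⌊2 * Y⌋₊

/-- `e(θ) = exp(2 π i θ)`. -/
noncomputable def e (θ : ℝ) : ℂ :=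
  Complex.exp (2 * Real.pi * Complex.I * θ)

/-- The polynomial `g(x) = (a/q) x² + β x + γ`. -/
noncomputable def g (a : ℤ) (q : ℕ) (β γ x : ℝ) : ℝ :=
  (a : ℝ) / (q : ℝ) * x ^ 2 + β * x + γ

/-- `L₁ = 2 N^(ρ - ε/2)`. -/
noncomputable def L₁ (ρ ε N : ℝ) : ℝ := 2 * N ^ (ρ - ε / 2)

/-- `L = N^(ρ - ε/3)`. -/
noncomputable def L (ρ ε N : ℝ) : ℝ := N ^ (ρ - ε / 3)

/-- `J` is an interval (of any kind, possibly empty) contained in `(N/(2m), N/m]`. -/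
def IsSubinterval (N : ℝ) (m : ℕ) (J : Set ℝ) : Prop :=
  J.OrdConnected ∧ J ⊆ Set.Ioc (N / (2 * m)) (N / m)

/-- The bilinear sum `∑_{ℓ ≤ L} c_ℓ ∑_{y ∼ Y} b_y ∑_{x ∈ I(y)} a_x e(ℓ g(xy))`. The cut-off
`x ≤ N/y` is implied by `x ∈ I(y)` and only serves to make the index set finite. -/
noncomputable def bilinearSum (ρ ε N Y : ℝ) (G : ℝ → ℝ) (I : ℕ → Set ℝ) (c b a : ℕ → ℂ) : ℂ :=
  ∑ ℓ ∈ Finset.Icc 1 ⌊L ρ ε N⌋₊, c ℓ *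
    ∑ y ∈ dyadic Y, b y *
      ∑ x ∈ natsUpTo (N / y) (I y), a x * e (ℓ * G ((x : ℝ) * (y : ℝ)))

theorem mem_dyadic {Y : ℝ} (hY : 0 ≤ Y) (y : ℕ) :
    y ∈ dyadic Y ↔ Y < y ∧ (y : ℝ) ≤ 2 * Y := by
  rw [dyadic, Finset.mem_Ioc, Nat.floor_lt hY, Nat.le_floor_iff (by positivity)]

/-- The index set of the inner sum is exactly the set of natural numbers in `I(y)`. -/
theorem mem_natsUpTo {N : ℝ} {m : ℕ} {J : Set ℝ} (hN : 0 < N) (hm : 0 < m)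
    (hJ : IsSubinterval N m J) (x : ℕ) : x ∈ natsUpTo (N / m) J ↔ (x : ℝ) ∈ J := by
  simp only [natsUpTo, Finset.mem_filter, Finset.mem_Icc]
  refine ⟨fun h => h.2, fun h => ⟨?_, h⟩⟩
  have hx := hJ.2 h
  have hm' : (0 : ℝ) < m := by exact_mod_cast hm
  have h0 : (0 : ℝ) < x := lt_trans (by positivity) hx.1
  exact ⟨by exact_mod_cast h0, Nat.le_floor hx.2⟩

end TypeII

/-!
Merge `ℓ` and `y` into one variable and apply Cauchy–Schwarz over `x`. The correlation of the pairs
`(ℓ, y)` and `(ℓ', y')` is a quadratic exponential sum over an interval of length at most `N / Y`,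
with leading coefficient `k a / q`, where `k = ℓ y² - ℓ' y'²`. By the divisor bound `k = 0` occurs
for few pairs. For `k ≠ 0`, Weyl differencing bounds the square of the correlation by
`∑ d, min (N / Y, ‖d k a / q‖⁻¹)`; by the divisor bound each value of `d k` arises `N ^ o(1)` times,
so its sum over `k` is controlled by complete periods modulo `q`. A second Cauchy–Schwarz, over `k`,
combines this with an estimate for the second moment of the number of representations of `k`.
That moment is estimated by applying Cauchy–Schwarz in `ℓ` once more, which reduces it to counting
solutions of `ℓ (y² - y'²) = n`; for fixed `n ≠ 0` the factors `ℓ` and `y + y'` divide `n`.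
-/

namespace TypeII

open Finset

section DivisorBound

theorem add_one_le_mul_rpow_pow {δ b : ℝ} (hδ : 0 < δ) (hb : 2 ≤ b) (k : ℕ) :
    (k + 1 : ℝ) ≤ max 1 (1 / (δ * Real.log 2)) * (b ^ δ) ^ k := by
  set c := max 1 (1 / (δ * Real.log 2))
  have hpos : 0 < δ * Real.log 2 := mul_pos hδ (Real.log_pos one_lt_two)
  have hc : 1 ≤ c := le_max_left _ _
  have hc' : 1 ≤ c * (δ * Real.log 2) := (div_le_iff₀ hpos).1 (le_max_right _ _)
  have hbase : 1 + δ * Real.log 2 ≤ b ^ δ := calc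
    1 + δ * Real.log 2 ≤ Real.exp (Real.log 2 * δ) := by
      linarith [Real.add_one_le_exp (Real.log 2 * δ)]
    _ = 2 ^ δ := (Real.rpow_def_of_pos two_pos δ).symm
    _ ≤ b ^ δ := Real.rpow_le_rpow zero_le_two hb hδ.le
  calc (k + 1 : ℝ) ≤ c * (1 + k * (δ * Real.log 2)) := by
        linarith [mul_le_mul_of_nonneg_left hc' k.cast_nonneg]
    _ ≤ c * (1 + δ * Real.log 2) ^ k := by
        gcongr
        exact one_add_mul_le_pow (by linarith) k
    _ ≤ c * (b ^ δ) ^ k := by gcongr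

theorem add_one_le_pow {b : ℝ} (hb : 2 ≤ b) (k : ℕ) : (k + 1 : ℝ) ≤ b ^ k := calc
  (k + 1 : ℝ) ≤ 2 ^ k := by exact_mod_cast Nat.lt_two_pow_self
  _ ≤ b ^ k := by gcongr

theorem exists_card_divisors_le {δ : ℝ} (hδ : 0 < δ) :
    ∃ C : ℝ, 1 ≤ C ∧ ∀ n : ℕ, n ≠ 0 → (#n.divisors : ℝ) ≤ C * (n : ℝ) ^ δ := by
  set c := max 1 (1 / (δ * Real.log 2))
  set P := ⌈(2 : ℝ) ^ δ⁻¹⌉₊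
  have hc : 1 ≤ c := le_max_left _ _
  refine ⟨c ^ P, one_le_pow₀ hc, fun n hn => ?_⟩
  have hlocal : ∀ p ∈ n.primeFactors, (n.factorization p + 1 : ℝ) ≤
      (if p < P then c else 1) * ((p : ℝ) ^ δ) ^ n.factorization p := by
    intro p hp
    split_ifs with hpP
    · exact add_one_le_mul_rpow_pow hδ
        (by exact_mod_cast (Nat.prime_of_mem_primeFactors hp).two_le) _
    · rw [one_mul]
      refine add_one_le_pow ?_ _
      rw [← Real.rpow_inv_le_iff_of_pos zero_le_two p.cast_nonneg hδ]
      exact (Nat.le_ceil _).trans (by exact_mod_cast not_lt.1 hpP)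
  have hsmall : ∏ p ∈ n.primeFactors, (if p < P then c else 1) ≤ c ^ P := by
    rw [prod_ite, prod_const_one, mul_one, prod_const]
    refine pow_le_pow_right₀ hc ((card_le_card fun p hp => ?_).trans_eq (card_range P))
    exact mem_range.2 (mem_filter.1 hp).2
  have hn' : ∏ p ∈ n.primeFactors, ((p : ℝ) ^ δ) ^ n.factorization p = (n : ℝ) ^ δ := by
    conv_rhs => rw [Nat.prod_primeFactors_pow_factorization hn]
    push_cast
    rw [← Real.finsetProd_rpow _ _ fun p _ => by positivity]
    exact prod_congr rfl fun p _ => Real.rpow_pow_comm p.cast_nonneg _ _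
  rw [Nat.card_divisors hn]
  push_cast
  calc ∏ p ∈ n.primeFactors, (n.factorization p + 1 : ℝ)
      ≤ ∏ p ∈ n.primeFactors,
          (if p < P then c else 1) * ((p : ℝ) ^ δ) ^ n.factorization p :=
        prod_le_prod (fun _ _ => by positivity) hlocal
    _ = (∏ p ∈ n.primeFactors, if p < P then c else 1) * (n : ℝ) ^ δ := by
        rw [prod_mul_distrib, hn']
    _ ≤ c ^ P * (n : ℝ) ^ δ := by gcongr

/-- The largest number of divisors of a positive integer up to `n`; the divisor bound
`maxDivisors n ≪ n ^ δ` keeps the loss in the counting arguments below any power of `N`. -/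
def maxDivisors (n : ℕ) : ℕ := (Icc 1 n).sup fun m => #m.divisors

theorem card_divisors_le_maxDivisors {m n : ℕ} (hm : m ≠ 0) (hmn : m ≤ n) :
    #m.divisors ≤ maxDivisors n :=
  le_sup (f := fun m => #m.divisors) (mem_Icc.2 ⟨Nat.one_le_iff_ne_zero.2 hm, hmn⟩)

theorem exists_maxDivisors_le {δ : ℝ} (hδ : 0 < δ) :
    ∃ C : ℝ, 1 ≤ C ∧ ∀ n : ℕ, (maxDivisors n : ℝ) ≤ C * (n : ℝ) ^ δ := by
  obtain ⟨C, hC, hdiv⟩ := exists_card_divisors_le hδ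
  refine ⟨C, hC, fun n => ?_⟩
  rw [maxDivisors, ← Nat.le_floor_iff (by positivity)]
  refine Finset.sup_le fun m hm => Nat.le_floor ((hdiv m ?_).trans ?_)
  · exact Nat.one_le_iff_ne_zero.1 (mem_Icc.1 hm).1
  · gcongr
    exact (mem_Icc.1 hm).2

end DivisorBound

section Character

theorem e_eq_exp (t : ℝ) : e t = Complex.exp ((2 * Real.pi * t : ℝ) * Complex.I) := by
  rw [e]
  congr 1
  push_cast
  ring

theorem e_add (s t : ℝ) : e (s + t) = e s * e t := by
  simp only [e, Complex.ofReal_add, mul_add, Complex.exp_add]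

theorem norm_e (t : ℝ) : ‖e t‖ = 1 := by
  rw [e_eq_exp, Complex.norm_exp_ofReal_mul_I]

theorem conj_e (t : ℝ) : (starRingEnd ℂ) (e t) = e (-t) := by
  rw [e_eq_exp, e_eq_exp, ← Complex.exp_conj]
  simp [Complex.conj_ofNat]

theorem e_nat_mul (n : ℕ) (t : ℝ) : e (n * t) = e t ^ n := by
  rw [e, e, ← Complex.exp_nat_mul]
  congr 1
  push_cast
  ring

theorem norm_e_sub_one (t : ℝ) : ‖e t - 1‖ = 2 * |Real.sin (Real.pi * t)| := by
  rw [e_eq_exp, mul_comm _ Complex.I, Complex.norm_exp_I_mul_ofReal_sub_one, norm_mul,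
    Real.norm_eq_abs, Real.norm_eq_abs, abs_two, mul_assoc, mul_div_cancel_left₀ _ two_ne_zero]

theorem four_mul_abs_le_norm_e_sub_one {t : ℝ} (ht : |t| ≤ 1 / 2) : 4 * |t| ≤ ‖e t - 1‖ := by
  have hpi := Real.pi_pos
  have habs : |Real.pi * t| = Real.pi * |t| := by rw [abs_mul, abs_of_pos hpi]
  have hsin := Real.mul_abs_le_abs_sin (x := Real.pi * t) (by rw [habs]; nlinarith)
  rw [habs, ← mul_assoc, div_mul_cancel₀ _ hpi.ne'] at hsin
  rw [norm_e_sub_one]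
  linarith

theorem e_intCast_div (q : ℕ) [NeZero q] (m : ℤ) :
    e (m / q) = ZMod.stdAddChar (m : ZMod q) := by
  rw [ZMod.stdAddChar_coe, e]
  push_cast
  rw [mul_div_assoc]

theorem e_valMinAbs_div (q : ℕ) [NeZero q] (m : ℤ) :
    e ((m : ZMod q).valMinAbs / q) = e (m / q) := by
  rw [e_intCast_div, e_intCast_div, ZMod.coe_valMinAbs]

theorem norm_sum_e_mul_norm_e_sub_one_le (t : ℝ) {J : Finset ℤ}
    (hJ : (J : Set ℤ).OrdConnected) : ‖∑ n ∈ J, e (n * t)‖ * ‖e t - 1‖ ≤ 2 := by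
  rcases J.eq_empty_or_nonempty with rfl | hne
  · simp
  set m := J.min' hne
  obtain ⟨k, hk⟩ : ∃ k : ℕ, J = Ico m (m + k) := by
    refine ⟨(J.max' hne + 1 - m).toNat, ?_⟩
    have hle : m ≤ J.max' hne := J.min'_le _ (J.max'_mem hne)
    rw [Int.toNat_of_nonneg (by omega), add_sub_cancel]
    ext n
    rw [mem_Ico, Int.lt_add_one_iff]
    exact ⟨fun hn => ⟨J.min'_le n hn, J.le_max' n hn⟩,
      fun hn => hJ.out (J.min'_mem hne) (J.max'_mem hne) hn⟩
  have hsum : ∑ n ∈ J, e (n * t) = e (m * t) * ∑ i ∈ range k, e t ^ i := by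
    rw [hk, Int.Ico_eq_finset_map, sum_map, mul_sum, add_sub_cancel_left, Int.toNat_natCast]
    refine sum_congr rfl fun i _ => ?_
    rw [← e_nat_mul, ← e_add, ← add_mul]
    simp
  rw [hsum, norm_mul, norm_e, one_mul, ← norm_mul, geom_sum_mul]
  calc ‖e t ^ k - 1‖ ≤ ‖e t ^ k‖ + ‖(1 : ℂ)‖ := norm_sub_le _ _
    _ = 2 := by rw [norm_pow, norm_e, one_pow, norm_one]; norm_num

end Character

section Kernel

/-- The majorant `min (X, ‖z / q‖⁻¹ / 2)` of the sums of at most `X` consecutive powers of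
`e (z / q)`, with the trivial bound `X` used only for `z = 0`. -/
noncomputable def kernelBound (q X : ℕ) (z : ZMod q) : ℝ :=
  if z = 0 then X else q / (2 * z.valMinAbs.natAbs)

theorem kernelBound_nonneg (q X : ℕ) (z : ZMod q) : 0 ≤ kernelBound q X z := by
  unfold kernelBound
  split_ifs <;> positivity

theorem norm_sum_e_le_kernelBound {q X : ℕ} [NeZero q] (m : ℤ) {J : Finset ℤ}
    (hJ : (J : Set ℤ).OrdConnected) (hX : #J ≤ X) :
    ‖∑ n ∈ J, e (n * (m / q))‖ ≤ kernelBound q X m := by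
  have hq : (0 : ℝ) < q := by exact_mod_cast NeZero.pos q
  unfold kernelBound
  split_ifs with hm
  · refine (norm_sum_le _ _).trans ?_
    simp only [norm_e, sum_const, nsmul_eq_mul, mul_one]
    exact_mod_cast hX
  set v := (m : ZMod q).valMinAbs
  have hv : 0 < (v.natAbs : ℝ) := by
    exact_mod_cast Int.natAbs_pos.2 fun h => hm ((ZMod.valMinAbs_eq_zero _).1 h)
  have habs : |(v / q : ℝ)| = v.natAbs / q := by
    rw [abs_div, Nat.abs_cast, Nat.cast_natAbs, Int.cast_abs]
  have hhalf : |(v / q : ℝ)| ≤ 1 / 2 := by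
    rw [habs, div_le_iff₀ hq]
    have hle : (v.natAbs : ℝ) ≤ (q / 2 : ℕ) := by exact_mod_cast ZMod.natAbs_valMinAbs_le _
    linarith [Nat.cast_div_le (α := ℝ) (m := q) (n := 2)]
  have hsub : 4 * (v.natAbs / q : ℝ) ≤ ‖e (m / q) - 1‖ := by
    rw [← e_valMinAbs_div, ← habs]
    exact four_mul_abs_le_norm_e_sub_one hhalf
  rw [le_div_iff₀ (by positivity)]
  calc ‖∑ n ∈ J, e (n * (m / q))‖ * (2 * v.natAbs)
      = ‖∑ n ∈ J, e (n * (m / q))‖ * (4 * (v.natAbs / q)) * (q / 2) := by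
        rw [mul_assoc]
        congr 1
        field_simp
        ring
    _ ≤ ‖∑ n ∈ J, e (n * (m / q))‖ * ‖e (m / q) - 1‖ * (q / 2) := by gcongr
    _ ≤ 2 * (q / 2) := by
        gcongr
        exact norm_sum_e_mul_norm_e_sub_one_le _ hJ
    _ = q := by ring

theorem sum_inv_val_le (q : ℕ) [NeZero q] : ∑ z : ZMod q, (z.val : ℝ)⁻¹ ≤ 1 + Real.log q := by
  calc ∑ z : ZMod q, (z.val : ℝ)⁻¹ = ∑ k ∈ range q, (k : ℝ)⁻¹ :=
        sum_nbij ZMod.val (fun z _ => mem_range.2 z.val_lt) (ZMod.val_injective q).injOn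
          (fun k hk => ⟨k, mem_univ _, ZMod.val_cast_of_lt (by simpa using hk)⟩) fun _ _ => rfl
    _ ≤ ∑ k ∈ range (q + 1), (k : ℝ)⁻¹ :=
        sum_le_sum_of_subset_of_nonneg (range_subset_range.2 q.le_succ) fun _ _ _ => by positivity
    _ = (harmonic q : ℝ) := by simp [sum_range_succ', harmonic]
    _ ≤ 1 + Real.log q := harmonic_le_one_add_log q

theorem inv_natAbs_valMinAbs_le {q : ℕ} [NeZero q] (z : ZMod q) :
    (z.valMinAbs.natAbs : ℝ)⁻¹ ≤ (z.val : ℝ)⁻¹ + ((-z).val : ℝ)⁻¹ := by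
  rcases eq_or_ne z 0 with rfl | hz
  · simp
  have := NeZero.mk hz
  rw [ZMod.valMinAbs_natAbs_eq_min, ← ZMod.val_neg_of_ne_zero]
  rcases min_choice z.val (-z).val with h | h <;> rw [h]
  · exact le_add_of_nonneg_right (by positivity)
  · exact le_add_of_nonneg_left (by positivity)

theorem sum_kernelBound_le (q X : ℕ) [NeZero q] :
    ∑ z : ZMod q, kernelBound q X z ≤ X + q * (1 + Real.log q) := by
  have hterm (z : ZMod q) : kernelBound q X z ≤
      (if z = 0 then (X : ℝ) else 0) + q / 2 * ((z.val : ℝ)⁻¹ + ((-z).val : ℝ)⁻¹) := by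
    unfold kernelBound
    split_ifs with hz
    · exact le_add_of_nonneg_right (by positivity)
    · rw [zero_add, div_mul_eq_div_div, div_eq_mul_inv (q / 2 : ℝ)]
      gcongr
      exact inv_natAbs_valMinAbs_le z
  have hneg : ∑ z : ZMod q, ((-z).val : ℝ)⁻¹ = ∑ z : ZMod q, (z.val : ℝ)⁻¹ :=
    Equiv.sum_comp (Equiv.neg (ZMod q)) fun z => (z.val : ℝ)⁻¹
  calc ∑ z : ZMod q, kernelBound q X z
      ≤ ∑ z : ZMod q, ((if z = 0 then (X : ℝ) else 0) +
          q / 2 * ((z.val : ℝ)⁻¹ + ((-z).val : ℝ)⁻¹)) := sum_le_sum fun z _ => hterm z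
    _ = X + q * ∑ z : ZMod q, (z.val : ℝ)⁻¹ := by
        rw [sum_add_distrib, ← mul_sum, sum_add_distrib, hneg, sum_ite_eq' univ (0 : ZMod q),
          if_pos (mem_univ _)]
        ring
    _ ≤ X + q * (1 + Real.log q) := by
        gcongr
        exact sum_inv_val_le q

end Kernel

section Periods

variable {q : ℕ} [NeZero q]

theorem card_filter_intCast_eq_le (B : ℕ) (z : ZMod q) :
    (#{n ∈ Icc (-B : ℤ) B | ((n : ℤ) : ZMod q) = z} : ℝ) ≤ (2 * B + 1) / q + 1 := by
  have hq : (0 : ℤ) < q := by exact_mod_cast NeZero.pos q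
  have hfilter : {n ∈ Icc (-B : ℤ) B | ((n : ℤ) : ZMod q) = z} =
      {n ∈ Ico (-B : ℤ) (B + 1) | n ≡ z.val [ZMOD q]} := by
    ext n
    simp [← ZMod.intCast_eq_intCast_iff]
  have hcard := Int.Ico_filter_modEq_card (-B) (B + 1) hq (z.val : ℤ)
  rw [← hfilter] at hcard
  have hround : (#{n ∈ Icc (-B : ℤ) B | ((n : ℤ) : ZMod q) = z} : ℚ) ≤ (2 * B + 1) / q + 1 := by
    rw [← Int.cast_natCast (R := ℚ), hcard, Int.cast_max, max_le_iff]
    refine ⟨?_, by push_cast; positivity⟩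
    push_cast
    have hup := Int.ceil_lt_add_one (((B : ℚ) + 1 - z.val) / q)
    have hlow := Int.le_ceil ((-(B : ℚ) - z.val) / q)
    have hsub : (2 * B + 1 : ℚ) / q = (B + 1 - z.val) / q - (-B - z.val) / q := by ring
    linarith
  simpa using (Rat.cast_le (K := ℝ)).2 hround

theorem sum_intCast_le (B : ℕ) {f : ZMod q → ℝ} (hf : ∀ z, 0 ≤ f z) :
    ∑ n ∈ Icc (-B : ℤ) B, f n ≤ ((2 * B + 1) / q + 1) * ∑ z, f z := by
  rw [← sum_fiberwise _ (fun n : ℤ => (n : ZMod q)), mul_sum]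
  refine sum_le_sum fun z _ => ?_
  rw [sum_congr rfl fun n hn => congrArg f (mem_filter.1 hn).2, sum_const, nsmul_eq_mul]
  exact mul_le_mul_of_nonneg_right (card_filter_intCast_eq_le B z) (hf z)

theorem sum_intCast_mul_le {a : ℤ} (ha : IsCoprime a q) (B : ℕ) {f : ZMod q → ℝ}
    (hf : ∀ z, 0 ≤ f z) :
    ∑ n ∈ Icc (-B : ℤ) B, f ((n * a : ℤ) : ZMod q) ≤ ((2 * B + 1) / q + 1) * ∑ z, f z := by
  obtain ⟨u, hu⟩ := (ZMod.coe_int_isUnit_iff_isCoprime a q).2 ha.symm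
  rw [← Equiv.sum_comp u.mulRight f]
  simp only [Units.mulRight_apply, hu, Int.cast_mul]
  exact sum_intCast_le B fun z : ZMod q => hf (z * a)

theorem sum_kernelBound_intCast_mul_le {a : ℤ} (ha : IsCoprime a q) (X B : ℕ) :
    ∑ n ∈ Icc (-B : ℤ) B, kernelBound q X ((n * a : ℤ) : ZMod q) ≤
      ((2 * B + 1) / q + 1) * (X + q * (1 + Real.log q)) := by
  refine (sum_intCast_mul_le ha B (kernelBound_nonneg q X)).trans ?_
  gcongr
  exact sum_kernelBound_le q X

end Periods

section WeylDifferencing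

theorem norm_sum_sq_le_sum_shift {G : Type*} [AddCommGroup G] [DecidableEq G] {J D : Finset G}
    (hD : ∀ x ∈ J, ∀ y ∈ J, x - y ∈ D) (z : G → ℂ) :
    ‖∑ x ∈ J, z x‖ ^ 2 ≤
      ∑ d ∈ D, ‖∑ y ∈ J with y + d ∈ J, z (y + d) * (starRingEnd ℂ) (z y)‖ := by
  have hshift (y : G) (hy : y ∈ J) : ∑ x ∈ J, z x = ∑ d ∈ D with y + d ∈ J, z (y + d) := by
    refine sum_nbij' (· - y) (y + ·) (fun x hx => ?_) (fun d hd => (mem_filter.1 hd).2)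
      (fun _ _ => add_sub_cancel _ _) (fun _ _ => add_sub_cancel_left _ _)
      (fun x _ => by rw [add_sub_cancel])
    rw [mem_filter, add_sub_cancel]
    exact ⟨hD x hx y hy, hx⟩
  have hexpand : (∑ x ∈ J, z x) * (starRingEnd ℂ) (∑ x ∈ J, z x) =
      ∑ d ∈ D, ∑ y ∈ J with y + d ∈ J, z (y + d) * (starRingEnd ℂ) (z y) := by
    rw [map_sum, mul_sum, sum_comm' (t' := J) (s' := fun y => {d ∈ D | y + d ∈ J})]
    · refine sum_congr rfl fun y hy => ?_
      rw [hshift y hy, sum_mul]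
    · simp only [mem_filter]
      tauto
  calc ‖∑ x ∈ J, z x‖ ^ 2 = ‖(∑ x ∈ J, z x) * (starRingEnd ℂ) (∑ x ∈ J, z x)‖ := by
        rw [norm_mul, RCLike.norm_conj, sq]
    _ ≤ _ := by
        rw [hexpand]
        exact norm_sum_le _ _

theorem ordConnected_filter_add_mem {J : Finset ℤ} (hJ : (J : Set ℤ).OrdConnected) (d : ℤ) :
    (↑{y ∈ J | y + d ∈ J} : Set ℤ).OrdConnected := by
  rw [coe_filter]
  exact hJ.inter (hJ.preimage_mono fun _ _ h => add_le_add_left h d)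

/-- Weyl's bound for the square of a quadratic exponential sum over an interval in `[1, X]` whose
leading coefficient is `m / q`. Differencing produces only the even `d`, with `d * m / q` the
frequency of a linear sum; the remaining `d` are included to keep the formula simple. -/
noncomputable def weylBound (q X : ℕ) (m : ℤ) : ℝ :=
  ∑ d ∈ Icc (-(2 * X : ℕ) : ℤ) (2 * X : ℕ), kernelBound q X ((d * m : ℤ) : ZMod q)

theorem weylBound_nonneg (q X : ℕ) (m : ℤ) : 0 ≤ weylBound q X m :=
  sum_nonneg fun _ _ => kernelBound_nonneg q X _

theorem norm_quadratic_sum_sq_le {q X : ℕ} [NeZero q] (m : ℤ) (φ ψ : ℝ) {J : Finset ℤ}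
    (hJ : (J : Set ℤ).OrdConnected) (hX : J ⊆ Icc 1 (X : ℤ)) :
    ‖∑ x ∈ J, e (m / q * x ^ 2 + φ * x + ψ)‖ ^ 2 ≤ weylBound q X m := by
  have hphase (d y : ℤ) : e (m / q * (y + d : ℤ) ^ 2 + φ * (y + d : ℤ) + ψ) *
      (starRingEnd ℂ) (e (m / q * y ^ 2 + φ * y + ψ)) =
      e (m / q * d ^ 2 + φ * d) * e (y * ((2 * d * m : ℤ) / q)) := by
    rw [conj_e, ← e_add, ← e_add]
    congr 1
    push_cast
    ring
  have hcard (d : ℤ) : #{y ∈ J | y + d ∈ J} ≤ X := by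
    simpa using (card_filter_le _ _).trans (card_le_card hX)
  calc ‖∑ x ∈ J, e (m / q * x ^ 2 + φ * x + ψ)‖ ^ 2
      ≤ ∑ d ∈ Icc (-X : ℤ) X, ‖∑ y ∈ J with y + d ∈ J,
          e (m / q * (y + d : ℤ) ^ 2 + φ * (y + d : ℤ) + ψ) *
            (starRingEnd ℂ) (e (m / q * y ^ 2 + φ * y + ψ))‖ := by
        refine norm_sum_sq_le_sum_shift (fun x hx y hy => ?_) _
        have hx := mem_Icc.1 (hX hx)
        have hy := mem_Icc.1 (hX hy)
        exact mem_Icc.2 ⟨by omega, by omega⟩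
    _ ≤ ∑ d ∈ Icc (-X : ℤ) X, kernelBound q X ((2 * d * m : ℤ) : ZMod q) := by
        refine sum_le_sum fun d _ => ?_
        simp only [hphase]
        rw [← mul_sum, norm_mul, norm_e, one_mul]
        exact norm_sum_e_le_kernelBound _ (ordConnected_filter_add_mem hJ d) (hcard d)
    _ = ∑ d ∈ (Icc (-X : ℤ) X).image (2 * ·), kernelBound q X ((d * m : ℤ) : ZMod q) := by
        rw [sum_image (mul_right_injective₀ two_ne_zero).injOn]
    _ ≤ weylBound q X m := by
        refine sum_le_sum_of_subset_of_nonneg (image_subset_iff.2 fun d hd => ?_)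
          fun _ _ _ => kernelBound_nonneg q X _
        have hd := mem_Icc.1 hd
        exact mem_Icc.2 ⟨by omega, by omega⟩

end WeylDifferencing

section MeanValue

theorem card_int_divisors (n : ℤ) : #n.divisors = 2 * #n.natAbs.divisors := by
  rw [Int.divisors, card_disjUnion, card_map, card_map, two_mul]

theorem card_filter_mul_eq_le {S T : Finset ℤ} {n : ℤ} (hn : n ≠ 0) :
    #{w ∈ S ×ˢ T | w.1 * w.2 = n} ≤ 2 * #n.natAbs.divisors := by
  rw [← card_int_divisors]
  refine card_le_card_of_injOn Prod.fst (fun w hw => ?_) fun w hw w' hw' h => Prod.ext h ?_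
  · exact Int.mem_divisors.2 ⟨Dvd.intro _ (mem_filter.1 hw).2, hn⟩
  · have hw := (mem_filter.1 hw).2
    have hw' := (mem_filter.1 hw').2
    rw [← h] at hw'
    exact mul_left_cancel₀ (left_ne_zero_of_mul (hw ▸ hn)) (hw.trans hw'.symm)

theorem sum_sum_mul_le {S T U : Finset ℤ} (hS : 0 ∉ S) (hT : 0 ∉ T)
    (hU : ∀ h ∈ S, ∀ d ∈ T, h * d ∈ U) {f : ℤ → ℝ} (hf : ∀ n, 0 ≤ f n) {D : ℕ}
    (hD : ∀ n ∈ U, n ≠ 0 → #n.natAbs.divisors ≤ D) :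
    ∑ h ∈ S, ∑ d ∈ T, f (h * d) ≤ 2 * D * ∑ n ∈ U, f n := by
  have hmaps : ∀ w ∈ S ×ˢ T, w.1 * w.2 ∈ U := fun w hw =>
    hU _ (mem_product.1 hw).1 _ (mem_product.1 hw).2
  rw [← sum_product' S T fun h d => f (h * d), ← sum_fiberwise_of_maps_to hmaps, mul_sum]
  refine sum_le_sum fun n hn => ?_
  rw [sum_congr rfl fun w hw => congrArg f (mem_filter.1 hw).2, sum_const, nsmul_eq_mul]
  refine mul_le_mul_of_nonneg_right ?_ (hf n)
  rcases eq_or_ne n 0 with rfl | hn0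
  · have hempty : {w ∈ S ×ˢ T | w.1 * w.2 = 0} = ∅ := by
      refine filter_false_of_mem fun w hw => mul_ne_zero ?_ ?_
      · exact ne_of_mem_of_not_mem (mem_product.1 hw).1 hS
      · exact ne_of_mem_of_not_mem (mem_product.1 hw).2 hT
    rw [hempty, card_empty, Nat.cast_zero]
    positivity
  · exact_mod_cast (card_filter_mul_eq_le hn0).trans (Nat.mul_le_mul_left 2 (hD n hn hn0))

theorem weylBound_eq_add_sum (q X : ℕ) (m : ℤ) :
    weylBound q X m = X + ∑ d ∈ (Icc (-(2 * X : ℕ) : ℤ) (2 * X : ℕ)).erase 0,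
      kernelBound q X ((d * m : ℤ) : ZMod q) := by
  rw [weylBound, ← add_sum_erase _ _ (mem_Icc.2 (by omega) : (0 : ℤ) ∈ _)]
  congr 1
  simp [kernelBound]

theorem sum_weylBound_le {q : ℕ} [NeZero q] {a : ℤ} (ha : IsCoprime a q) (X H : ℕ) :
    ∑ h ∈ (Icc (-H : ℤ) H).erase 0, weylBound q X (h * a) ≤
      2 * H * X + 2 * maxDivisors (2 * H * X) *
        (((4 * H * X + 1) / q + 1) * (X + q * (1 + Real.log q))) := by
  set S := (Icc (-H : ℤ) H).erase 0
  set T := (Icc (-(2 * X : ℕ) : ℤ) (2 * X : ℕ)).erase 0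
  set U := Icc (-(2 * H * X : ℕ) : ℤ) (2 * H * X : ℕ)
  set f : ℤ → ℝ := fun n => kernelBound q X ((n * a : ℤ) : ZMod q)
  have hf (n : ℤ) : 0 ≤ f n := kernelBound_nonneg q X _
  have hsplit (h : ℤ) : weylBound q X (h * a) = X + ∑ d ∈ T, f (h * d) := by
    rw [weylBound_eq_add_sum]
    simp only [f, T, mul_assoc, mul_left_comm h]
  have hcard : #S = 2 * H := by
    rw [card_erase_of_mem (mem_Icc.2 (by omega)), Int.card_Icc]
    omega
  have hU : ∀ h ∈ S, ∀ d ∈ T, h * d ∈ U := fun h hh d hd => by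
    have hh := abs_le.2 (mem_Icc.1 (mem_of_mem_erase hh))
    have hd := abs_le.2 (mem_Icc.1 (mem_of_mem_erase hd))
    rw [mem_Icc, ← abs_le, abs_mul]
    calc |h| * |d| ≤ H * (2 * X : ℕ) := by gcongr
      _ = (2 * H * X : ℕ) := by push_cast; ring
  have hD : ∀ n ∈ U, n ≠ 0 → #n.natAbs.divisors ≤ maxDivisors (2 * H * X) := fun n hn hn0 => by
    have hn := mem_Icc.1 hn
    exact card_divisors_le_maxDivisors (Int.natAbs_ne_zero.2 hn0) (by omega)
  have hperiods : ∑ n ∈ U, f n ≤ ((4 * H * X + 1) / q + 1) * (X + q * (1 + Real.log q)) := by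
    refine (sum_kernelBound_intCast_mul_le ha X _).trans_eq ?_
    push_cast
    ring
  simp only [hsplit]
  rw [sum_add_distrib, sum_const, hcard, nsmul_eq_mul]
  push_cast
  gcongr
  calc ∑ h ∈ S, ∑ d ∈ T, f (h * d) ≤ 2 * maxDivisors (2 * H * X) * ∑ n ∈ U, f n :=
        sum_sum_mul_le (notMem_erase _ _) (notMem_erase _ _) hU hf hD
    _ ≤ _ := by gcongr

end MeanValue

section DifferenceCounts

variable {α β : Type*}

theorem sum_card_fiber_sq_le [DecidableEq β] (s : Finset α) (φ : α → β) (T : Finset β) :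
    ∑ b ∈ T, #{x ∈ s | φ x = b} ^ 2 ≤ #{w ∈ s ×ˢ s | φ w.1 = φ w.2} := by
  have hfiber (b : β) : #{x ∈ s | φ x = b} ^ 2 =
      #{w ∈ {w ∈ s ×ˢ s | φ w.1 = φ w.2} | φ w.1 = b} := by
    rw [sq, ← card_product, ← filter_product, filter_filter]
    congr 1
    refine filter_congr fun w _ => ⟨fun h => ⟨h.1.trans h.2.symm, h.1⟩, fun h => ⟨h.2, ?_⟩⟩
    exact h.1.symm.trans h.2
  simp only [hfiber]
  rw [sum_card_fiberwise_eq_card_filter]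
  exact card_filter_le _ _

/-- The number of representations of `k` as a difference of two values of `φ` on `s`. -/
def diffCount (φ : α → ℤ) (s : Finset α) (k : ℤ) : ℕ :=
  #{w ∈ s ×ˢ s | φ w.1 - φ w.2 = k}

theorem diffCount_eq_sum (φ : α → ℤ) (s : Finset α) (k : ℤ) :
    diffCount φ s k = ∑ p ∈ s, #{p' ∈ s | φ p - φ p' = k} := by
  simp only [diffCount, card_filter, sum_product]

-- Both sides count the solutions of `f b - h p = f b' - h p'`, that is, of
-- `f b - f b' = h p - h p'`.
theorem sum_card_sub_eq_sq_le (f : β → ℤ) (B : Finset β) (h : α → ℤ) (P : Finset α)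
    (T : Finset ℤ) :
    ∑ k ∈ T, #{x ∈ B ×ˢ P | f x.1 - h x.2 = k} ^ 2 ≤
      ∑ w ∈ P ×ˢ P, diffCount f B (h w.1 - h w.2) := by
  refine (sum_card_fiber_sq_le _ _ T).trans_eq ?_
  calc #{w ∈ (B ×ˢ P) ×ˢ (B ×ˢ P) | f w.1.1 - h w.1.2 = f w.2.1 - h w.2.2}
      = #{w ∈ (P ×ˢ P) ×ˢ (B ×ˢ B) | f w.2.1 - f w.2.2 = h w.1.1 - h w.1.2} := by
        refine card_nbij' (fun w => ((w.1.2, w.2.2), (w.1.1, w.2.1)))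
          (fun w => ((w.2.1, w.1.1), (w.2.2, w.1.2))) ?_ ?_ (fun _ _ => rfl) (fun _ _ => rfl)
        all_goals
          intro w hw
          simp only [coe_filter, mem_product, Set.mem_ofPred_eq] at hw ⊢
          exact ⟨by tauto, by linarith [hw.2]⟩
    _ = ∑ w ∈ P ×ˢ P, diffCount f B (h w.1 - h w.2) := by
        simp only [diffCount, card_filter, sum_product]

theorem sum_diffCount_product_sq_le (φ : α × β → ℤ) (A : Finset α) (B : Finset β)
    (T : Finset ℤ) :
    ∑ k ∈ T, diffCount φ (A ×ˢ B) k ^ 2 ≤ #A * ∑ w ∈ (A ×ˢ B) ×ˢ (A ×ˢ B),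
      ∑ l ∈ A, diffCount (fun y => φ (l, y)) B (φ w.1 - φ w.2) := by
  set P := A ×ˢ B
  have hsplit (k : ℤ) : diffCount φ P k =
      ∑ l ∈ A, #{x ∈ B ×ˢ P | φ (l, x.1) - φ x.2 = k} := by
    rw [diffCount_eq_sum, sum_product]
    simp only [card_filter, sum_product B P]
  calc ∑ k ∈ T, diffCount φ P k ^ 2
      ≤ ∑ k ∈ T, #A * ∑ l ∈ A, #{x ∈ B ×ˢ P | φ (l, x.1) - φ x.2 = k} ^ 2 := by
        refine sum_le_sum fun k _ => ?_
        rw [hsplit]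
        exact sq_sum_le_card_mul_sum_sq
    _ = #A * ∑ l ∈ A, ∑ k ∈ T, #{x ∈ B ×ˢ P | φ (l, x.1) - φ x.2 = k} ^ 2 := by
        rw [← mul_sum, sum_comm]
    _ ≤ #A * ∑ l ∈ A, ∑ w ∈ P ×ˢ P, diffCount (fun y => φ (l, y)) B (φ w.1 - φ w.2) := by
        gcongr with l
        exact sum_card_sub_eq_sq_le (fun y => φ (l, y)) B φ P T
    _ = _ := by rw [sum_comm]

end DifferenceCounts

section Energy

/-- The integer `ℓ y²` attached to a pair `(ℓ, y)`: the phases `ℓ g(xy)` and `ℓ' g(xy')` differ by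
a quadratic polynomial in `x` with leading coefficient `(ℓ y² - ℓ' y'²) a / q`. -/
def mulSq (p : ℕ × ℕ) : ℤ := p.1 * p.2 ^ 2

theorem diffCount_mulSq_left_zero_le {l : ℕ} (hl : l ≠ 0) (Y : Finset ℕ) :
    diffCount (fun y => mulSq (l, y)) Y 0 ≤ #Y := by
  refine card_le_card_of_injOn Prod.fst (fun w hw => (mem_product.1 (mem_filter.1 hw).1).1) ?_
  have hdiag : ∀ w ∈ {w ∈ Y ×ˢ Y | mulSq (l, w.1) - mulSq (l, w.2) = 0}, w.1 = w.2 := by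
    intro w hw
    have hw : (l * w.1 ^ 2 : ℤ) = l * w.2 ^ 2 := sub_eq_zero.1 (mem_filter.1 hw).2
    exact Nat.pow_left_injective two_ne_zero
      (by exact_mod_cast mul_left_cancel₀ (Nat.cast_ne_zero.2 hl) hw)
  exact fun w hw w' hw' h => Prod.ext h ((hdiag w hw).symm.trans (h.trans (hdiag w' hw')))

theorem diffCount_mulSq_left_le (l : ℕ) (Y : Finset ℕ) {k : ℤ} (hk : k ≠ 0) :
    diffCount (fun y => mulSq (l, y)) Y k ≤
      if l ∈ k.natAbs.divisors then #k.natAbs.divisors else 0 := by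
  have hfactor : ∀ w ∈ {w ∈ Y ×ˢ Y | mulSq (l, w.1) - mulSq (l, w.2) = k},
      (l : ℤ) * (w.1 + w.2 : ℕ) * (w.1 - w.2) = k := by
    intro w hw
    rw [← (mem_filter.1 hw).2, mulSq, mulSq]
    push_cast
    ring
  split_ifs with hl
  · refine card_le_card_of_injOn (fun w => w.1 + w.2) (fun w hw => ?_) fun w hw w' hw' h => ?_
    · refine Nat.mem_divisors.2 ⟨Int.natCast_dvd.1 ?_, Int.natAbs_ne_zero.2 hk⟩
      exact ⟨l * (w.1 - w.2), by rw [← hfactor w hw]; ring⟩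
    · have hw := hfactor w hw
      have hw' := hfactor w' hw'
      simp only at h
      rw [← h] at hw'
      have hsub := mul_left_cancel₀ (left_ne_zero_of_mul (hw ▸ hk)) (hw.trans hw'.symm)
      exact Prod.ext (by omega) (by omega)
  · refine (card_eq_zero.2 (filter_eq_empty_iff.2 fun w hw h => hl ?_)).le
    have hw := hfactor w (mem_filter.2 ⟨hw, h⟩)
    refine Nat.mem_divisors.2 ⟨Int.natCast_dvd.1 ?_, Int.natAbs_ne_zero.2 hk⟩
    exact ⟨_, by rw [← hw, mul_assoc]⟩

theorem sum_diffCount_mulSq_left_le (A Y : Finset ℕ) {k : ℤ} (hk : k ≠ 0) :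
    ∑ l ∈ A, diffCount (fun y => mulSq (l, y)) Y k ≤ #k.natAbs.divisors ^ 2 := by
  refine (sum_le_sum fun l _ => diffCount_mulSq_left_le l Y hk).trans ?_
  rw [← sum_filter, sum_const, smul_eq_mul, sq]
  exact Nat.mul_le_mul_right _ (card_le_card fun l hl => (mem_filter.1 hl).2)

theorem card_filter_mulSq_eq_le (P : Finset (ℕ × ℕ)) {n : ℕ} (hn : n ≠ 0) :
    #{p ∈ P | mulSq p = n} ≤ #n.divisors := by
  have hmul : ∀ p ∈ {p ∈ P | mulSq p = n}, p.1 * p.2 ^ 2 = n := by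
    intro p hp
    have hp : (p.1 * p.2 ^ 2 : ℤ) = n := (mem_filter.1 hp).2
    exact_mod_cast hp
  refine card_le_card_of_injOn Prod.snd (fun p hp => ?_) fun p hp p' hp' h => Prod.ext ?_ h
  · exact Nat.mem_divisors.2 ⟨⟨p.1 * p.2, by rw [← hmul p hp]; ring⟩, hn⟩
  · have hp := hmul p hp
    have hp' := hmul p' hp'
    rw [← h] at hp'
    exact mul_right_cancel₀ (right_ne_zero_of_mul (hp ▸ hn)) (hp.trans hp'.symm)

variable {Λ M : ℕ} {Y : Finset ℕ}

theorem mulSq_bounds (hY : Y ⊆ Icc 1 M) {p : ℕ × ℕ} (hp : p ∈ Icc 1 Λ ×ˢ Y) :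
    0 < mulSq p ∧ mulSq p ≤ (Λ * M ^ 2 : ℕ) := by
  obtain ⟨hl, hy⟩ := mem_product.1 hp
  obtain ⟨hl, hl'⟩ := mem_Icc.1 hl
  obtain ⟨hy, hy'⟩ := mem_Icc.1 (hY hy)
  unfold mulSq
  norm_cast
  exact ⟨by positivity, Nat.mul_le_mul hl' (Nat.pow_le_pow_left hy' 2)⟩

theorem card_pairs_le (hY : Y ⊆ Icc 1 M) : #(Icc 1 Λ ×ˢ Y) ≤ Λ * M := by
  rw [card_product]
  exact Nat.mul_le_mul (by simp) (by simpa using card_le_card hY)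

theorem diffCount_mulSq_zero_le (hY : Y ⊆ Icc 1 M) :
    diffCount mulSq (Icc 1 Λ ×ˢ Y) 0 ≤ Λ * M * maxDivisors (Λ * M ^ 2) := by
  rw [diffCount_eq_sum]
  refine (sum_le_card_nsmul _ _ (maxDivisors (Λ * M ^ 2)) fun p hp => ?_).trans
    (Nat.mul_le_mul_right _ (card_pairs_le hY))
  obtain ⟨hpos, hle⟩ := mulSq_bounds hY hp
  obtain ⟨n, hn⟩ := Int.eq_ofNat_of_zero_le hpos.le
  have hn0 : n ≠ 0 := by omega
  simp only [sub_eq_zero, eq_comm (a := mulSq p)]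
  rw [hn]
  exact (card_filter_mulSq_eq_le _ hn0).trans (card_divisors_le_maxDivisors hn0 (by omega))

theorem sum_diffCount_mulSq_left_sub_le (hY : Y ⊆ Icc 1 M) {p p' : ℕ × ℕ}
    (hp : p ∈ Icc 1 Λ ×ˢ Y) (hp' : p' ∈ Icc 1 Λ ×ˢ Y) :
    ∑ l ∈ Icc 1 Λ, diffCount (fun y => mulSq (l, y)) Y (mulSq p - mulSq p') ≤
      (if mulSq p - mulSq p' = 0 then Λ * M else 0) + maxDivisors (Λ * M ^ 2) ^ 2 := by
  split_ifs with h
  · rw [h]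
    refine le_add_right ((sum_le_card_nsmul _ _ #Y fun l hl => ?_).trans ?_)
    · exact diffCount_mulSq_left_zero_le (Nat.one_le_iff_ne_zero.1 (mem_Icc.1 hl).1) Y
    · rw [smul_eq_mul, ← card_product]
      exact card_pairs_le hY
  · rw [zero_add]
    refine (sum_diffCount_mulSq_left_le _ Y h).trans (Nat.pow_le_pow_left ?_ 2)
    have hp := mulSq_bounds hY hp
    have hp' := mulSq_bounds hY hp'
    exact card_divisors_le_maxDivisors (Int.natAbs_ne_zero.2 h) (by omega)

theorem sum_diffCount_mulSq_sq_le (hY : Y ⊆ Icc 1 M) (T : Finset ℤ) :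
    ∑ k ∈ T, diffCount mulSq (Icc 1 Λ ×ˢ Y) k ^ 2 ≤
      2 * Λ ^ 3 * M ^ 2 * maxDivisors (Λ * M ^ 2) ^ 2 := by
  set P := Icc 1 Λ ×ˢ Y
  set D := maxDivisors (Λ * M ^ 2)
  calc ∑ k ∈ T, diffCount mulSq P k ^ 2
      ≤ #(Icc 1 Λ) * ∑ w ∈ P ×ˢ P,
          ∑ l ∈ Icc 1 Λ, diffCount (fun y => mulSq (l, y)) Y (mulSq w.1 - mulSq w.2) :=
        sum_diffCount_product_sq_le mulSq _ _ T
    _ ≤ Λ * ∑ w ∈ P ×ˢ P, ((if mulSq w.1 - mulSq w.2 = 0 then Λ * M else 0) + D ^ 2) := by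
        gcongr with w hw
        · simp
        · obtain ⟨hw, hw'⟩ := mem_product.1 hw
          exact sum_diffCount_mulSq_left_sub_le hY hw hw'
    _ = Λ * (diffCount mulSq P 0 * (Λ * M) + #P * #P * D ^ 2) := by
        rw [sum_add_distrib, ← sum_filter, sum_const, sum_const, smul_eq_mul, smul_eq_mul,
          card_product, diffCount]
    _ ≤ Λ * (Λ * M * D ^ 2 * (Λ * M) + Λ * M * (Λ * M) * D ^ 2) := by
        gcongr
        · exact (diffCount_mulSq_zero_le hY).trans
            (Nat.mul_le_mul_left _ (Nat.le_self_pow two_ne_zero D))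
        · exact card_pairs_le hY
        · exact card_pairs_le hY
    _ = 2 * Λ ^ 3 * M ^ 2 * D ^ 2 := by ring

end Energy

section Bilinear

theorem norm_sum_mul_sum_sq_le {ι α : Type*} (P : Finset ι) (s : Finset α) {d : α → ℂ}
    (hd : ∀ x, ‖d x‖ ≤ 1) (t : ι → α → ℂ) :
    ‖∑ x ∈ s, d x * ∑ p ∈ P, t p x‖ ^ 2 ≤
      #s * ∑ v ∈ P ×ˢ P, ‖∑ x ∈ s, t v.1 x * (starRingEnd ℂ) (t v.2 x)‖ := by
  have hexpand : ∑ v ∈ P ×ˢ P, ∑ x ∈ s, t v.1 x * (starRingEnd ℂ) (t v.2 x) =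
      ((∑ x ∈ s, ‖∑ p ∈ P, t p x‖ ^ 2 : ℝ) : ℂ) := by
    rw [sum_comm, Complex.ofReal_sum]
    refine sum_congr rfl fun x _ => ?_
    rw [sum_product' P P fun p p' => t p x * (starRingEnd ℂ) (t p' x), ← sum_mul_sum, ← map_sum,
      Complex.mul_conj, Complex.normSq_eq_norm_sq]
  calc ‖∑ x ∈ s, d x * ∑ p ∈ P, t p x‖ ^ 2 ≤ (∑ x ∈ s, ‖∑ p ∈ P, t p x‖) ^ 2 := by
        gcongr
        refine (norm_sum_le _ _).trans (sum_le_sum fun x _ => ?_)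
        rw [norm_mul]
        exact mul_le_of_le_one_left (norm_nonneg _) (hd x)
    _ ≤ #s * ∑ x ∈ s, ‖∑ p ∈ P, t p x‖ ^ 2 := sq_sum_le_card_mul_sum_sq
    _ = #s * ‖∑ v ∈ P ×ˢ P, ∑ x ∈ s, t v.1 x * (starRingEnd ℂ) (t v.2 x)‖ := by
        rw [hexpand, Complex.norm_of_nonneg (sum_nonneg fun _ _ => sq_nonneg _)]
    _ ≤ _ := by
        gcongr
        exact norm_sum_le _ _

theorem norm_sum_weighted_sum_sq_le {ι α : Type*} [DecidableEq α] {P : Finset ι} {s : Finset α}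
    {J : ι → Finset α} (hJ : ∀ p ∈ P, J p ⊆ s) {w : ι → ℂ} (hw : ∀ p, ‖w p‖ ≤ 1) {d : α → ℂ}
    (hd : ∀ x, ‖d x‖ ≤ 1) (u : ι → α → ℂ) :
    ‖∑ p ∈ P, w p * ∑ x ∈ J p, d x * u p x‖ ^ 2 ≤
      #s * ∑ v ∈ P ×ˢ P, ‖∑ x ∈ J v.1 ∩ J v.2, u v.1 x * (starRingEnd ℂ) (u v.2 x)‖ := by
  set t : ι → α → ℂ := fun p x => if x ∈ J p then w p * u p x else 0
  have hswap : ∑ p ∈ P, w p * ∑ x ∈ J p, d x * u p x = ∑ x ∈ s, d x * ∑ p ∈ P, t p x := by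
    simp only [mul_sum]
    rw [sum_comm (s := s)]
    refine sum_congr rfl fun p hp => ?_
    simp only [t, mul_ite, mul_zero]
    rw [← sum_filter, filter_mem_eq_inter, inter_eq_right.2 (hJ p hp)]
    exact sum_congr rfl fun x _ => mul_left_comm _ _ _
  rw [hswap]
  refine (norm_sum_mul_sum_sq_le P s hd t).trans ?_
  gcongr with v hv
  have hpull : ∑ x ∈ s, t v.1 x * (starRingEnd ℂ) (t v.2 x) =
      w v.1 * (starRingEnd ℂ) (w v.2) *
        ∑ x ∈ J v.1 ∩ J v.2, u v.1 x * (starRingEnd ℂ) (u v.2 x) := by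
    have hsub : J v.1 ∩ J v.2 ⊆ s := inter_subset_left.trans (hJ _ (mem_product.1 hv).1)
    rw [mul_sum, ← inter_eq_right.2 hsub, ← filter_mem_eq_inter, sum_filter]
    refine sum_congr rfl fun x _ => ?_
    by_cases hx : x ∈ J v.1 <;> by_cases hx' : x ∈ J v.2 <;>
      simp only [t, hx, hx', mem_inter, and_true, and_false, if_true, if_false, map_zero, map_mul,
        mul_zero, zero_mul]
    exact mul_mul_mul_comm _ _ _ _
  rw [hpull, norm_mul, norm_mul, RCLike.norm_conj]
  exact mul_le_of_le_one_left (norm_nonneg _) (mul_le_one₀ (hw _) (norm_nonneg _) (hw _))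

theorem ordConnected_map_castEmbedding {J : Finset ℕ} (hJ : (J : Set ℕ).OrdConnected) :
    (↑(J.map (Nat.castEmbedding (R := ℤ))) : Set ℤ).OrdConnected := by
  refine ⟨fun x hx z hz k hk => ?_⟩
  obtain ⟨m, hm, rfl⟩ := mem_map.1 hx
  obtain ⟨n, hn, rfl⟩ := mem_map.1 hz
  lift k to ℕ using (Int.natCast_nonneg m).trans hk.1
  exact mem_map_of_mem _ (hJ.out hm hn ⟨Int.ofNat_le.1 hk.1, Int.ofNat_le.1 hk.2⟩)

variable {q X : ℕ} [NeZero q]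

theorem norm_sum_mul_conj_sq_le (a : ℤ) (β γ : ℝ) {K : Finset ℕ}
    (hK : (K : Set ℕ).OrdConnected) (hX : K ⊆ Icc 1 X) (p p' : ℕ × ℕ) :
    ‖∑ x ∈ K, e (p.1 * g a q β γ (x * p.2)) *
        (starRingEnd ℂ) (e (p'.1 * g a q β γ (x * p'.2)))‖ ^ 2 ≤
      weylBound q X ((mulSq p - mulSq p') * a) := by
  have hphase (x : ℕ) : e (p.1 * g a q β γ (x * p.2)) *
      (starRingEnd ℂ) (e (p'.1 * g a q β γ (x * p'.2))) =
      e (((mulSq p - mulSq p') * a : ℤ) / q * (x : ℤ) ^ 2 +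
        (p.1 * p.2 - p'.1 * p'.2) * β * (x : ℤ) + (p.1 - p'.1) * γ) := by
    rw [conj_e, ← e_add]
    congr 1
    simp only [g, mulSq]
    push_cast
    ring
  have hmap : K.map Nat.castEmbedding ⊆ Icc 1 (X : ℤ) := fun x hx => by
    obtain ⟨n, hn, rfl⟩ := mem_map.1 hx
    have hn := mem_Icc.1 (hX hn)
    exact mem_Icc.2 ⟨Int.ofNat_le.2 hn.1, Int.ofNat_le.2 hn.2⟩
  have hbound := norm_quadratic_sum_sq_le (q := q) ((mulSq p - mulSq p') * a)
    ((p.1 * p.2 - p'.1 * p'.2) * β) ((p.1 - p'.1) * γ) (ordConnected_map_castEmbedding hK) hmap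
  rw [sum_map] at hbound
  simp only [hphase]
  exact hbound

theorem norm_sum_mul_conj_le (a : ℤ) (β γ : ℝ) {K : Finset ℕ}
    (hK : (K : Set ℕ).OrdConnected) (hX : K ⊆ Icc 1 X) (p p' : ℕ × ℕ) :
    ‖∑ x ∈ K, e (p.1 * g a q β γ (x * p.2)) *
        (starRingEnd ℂ) (e (p'.1 * g a q β γ (x * p'.2)))‖ ≤
      if mulSq p - mulSq p' = 0 then (X : ℝ) else √(weylBound q X ((mulSq p - mulSq p') * a)) := by
  split_ifs with h
  · calc _ ≤ ∑ _ ∈ K, (1 : ℝ) := norm_sum_le_of_le K fun _ _ => by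
          rw [norm_mul, RCLike.norm_conj, norm_e, norm_e, one_mul]
      _ ≤ X := by simpa using card_le_card hX
  · exact Real.le_sqrt_of_sq_le (norm_sum_mul_conj_sq_le a β γ hK hX p p')

theorem sum_pairs_eq_sum_diffCount {ι : Type*} {φ : ι → ℤ} {P : Finset ι} {T : Finset ℤ}
    (hT : ∀ v ∈ P ×ˢ P, φ v.1 - φ v.2 ∈ T) (W : ℤ → ℝ) :
    ∑ v ∈ P ×ˢ P, W (φ v.1 - φ v.2) = ∑ k ∈ T, diffCount φ P k * W k := by
  rw [← sum_fiberwise_of_maps_to hT]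
  refine sum_congr rfl fun k _ => ?_
  rw [sum_congr rfl fun v hv => congrArg W (mem_filter.1 hv).2, sum_const, nsmul_eq_mul, diffCount]

variable {Λ M : ℕ} {Y : Finset ℕ}

theorem sum_diffCount_mul_sqrt_weylBound_le (hY : Y ⊆ Icc 1 M) {a : ℤ} (ha : IsCoprime a q)
    (X H : ℕ) :
    ∑ k ∈ (Icc (-H : ℤ) H).erase 0,
        diffCount mulSq (Icc 1 Λ ×ˢ Y) k * √(weylBound q X (k * a)) ≤
      √(2 * Λ ^ 3 * M ^ 2 * maxDivisors (Λ * M ^ 2) ^ 2) *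
        √(2 * H * X + 2 * maxDivisors (2 * H * X) *
          (((4 * H * X + 1) / q + 1) * (X + q * (1 + Real.log q)))) := by
  refine (Real.sum_mul_le_sqrt_mul_sqrt _ _ _).trans ?_
  simp only [Real.sq_sqrt (weylBound_nonneg q X _)]
  gcongr
  · exact_mod_cast sum_diffCount_mulSq_sq_le hY _
  · exact sum_weylBound_le ha X H

theorem sum_correlations_le (hY : Y ⊆ Icc 1 M) {a : ℤ} (ha : IsCoprime a q) (X : ℕ) :
    ∑ v ∈ (Icc 1 Λ ×ˢ Y) ×ˢ (Icc 1 Λ ×ˢ Y), (if mulSq v.1 - mulSq v.2 = 0 then (X : ℝ)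
        else √(weylBound q X ((mulSq v.1 - mulSq v.2) * a))) ≤
      Λ * M * maxDivisors (Λ * M ^ 2) * X +
        √(2 * Λ ^ 3 * M ^ 2 * maxDivisors (Λ * M ^ 2) ^ 2) *
          √(2 * (Λ * M ^ 2 : ℕ) * X + 2 * maxDivisors (2 * (Λ * M ^ 2) * X) *
            (((4 * (Λ * M ^ 2 : ℕ) * X + 1) / q + 1) * (X + q * (1 + Real.log q)))) := by
  set P := Icc 1 Λ ×ˢ Y
  set H := Λ * M ^ 2
  set W : ℤ → ℝ := fun k => if k = 0 then (X : ℝ) else √(weylBound q X (k * a))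
  have hmaps : ∀ v ∈ P ×ˢ P, mulSq v.1 - mulSq v.2 ∈ Icc (-H : ℤ) H := by
    intro v hv
    have hp := mulSq_bounds hY (mem_product.1 hv).1
    have hp' := mulSq_bounds hY (mem_product.1 hv).2
    exact mem_Icc.2 ⟨by omega, by omega⟩
  have hzero : (0 : ℤ) ∈ Icc (-H : ℤ) H := mem_Icc.2 (by omega)
  calc ∑ v ∈ P ×ˢ P, W (mulSq v.1 - mulSq v.2)
      = diffCount mulSq P 0 * X + ∑ k ∈ (Icc (-H : ℤ) H).erase 0,
          diffCount mulSq P k * √(weylBound q X (k * a)) := by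
        rw [sum_pairs_eq_sum_diffCount hmaps, ← add_sum_erase _ _ hzero]
        simp only [W, if_true]
        congr 1
        exact sum_congr rfl fun k hk => by rw [if_neg (ne_of_mem_erase hk)]
    _ ≤ _ := by
        gcongr
        · exact_mod_cast diffCount_mulSq_zero_le hY
        · exact sum_diffCount_mul_sqrt_weylBound_le hY ha X H

theorem norm_bilinear_sq_le (hY : Y ⊆ Icc 1 M) {J : ℕ → Finset ℕ} (hJ : ∀ y ∈ Y, J y ⊆ Icc 1 X)
    (hconn : ∀ y ∈ Y, (J y : Set ℕ).OrdConnected) {a : ℤ} (ha : IsCoprime a q) (β γ : ℝ)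
    {c b d : ℕ → ℂ} (hc : ∀ l, ‖c l‖ ≤ 1) (hb : ∀ y, ‖b y‖ ≤ 1) (hd : ∀ x, ‖d x‖ ≤ 1) :
    ‖∑ l ∈ Icc 1 Λ, c l * ∑ y ∈ Y, b y * ∑ x ∈ J y, d x * e (l * g a q β γ (x * y))‖ ^ 2 ≤
      X * (Λ * M * maxDivisors (Λ * M ^ 2) * X +
        √(2 * Λ ^ 3 * M ^ 2 * maxDivisors (Λ * M ^ 2) ^ 2) *
          √(2 * (Λ * M ^ 2 : ℕ) * X + 2 * maxDivisors (2 * (Λ * M ^ 2) * X) *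
            (((4 * (Λ * M ^ 2 : ℕ) * X + 1) / q + 1) * (X + q * (1 + Real.log q))))) := by
  set P := Icc 1 Λ ×ˢ Y
  set u : ℕ × ℕ → ℕ → ℂ := fun p x => e (p.1 * g a q β γ (x * p.2))
  have hsum : ∑ l ∈ Icc 1 Λ, c l * ∑ y ∈ Y, b y * ∑ x ∈ J y, d x * e (l * g a q β γ (x * y)) =
      ∑ p ∈ P, c p.1 * b p.2 * ∑ x ∈ J p.2, d x * u p x := by
    simp only [P, u, sum_product, mul_sum, mul_assoc]
  have hweight (p : ℕ × ℕ) : ‖c p.1 * b p.2‖ ≤ 1 := by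
    rw [norm_mul]
    exact mul_le_one₀ (hc _) (norm_nonneg _) (hb _)
  rw [hsum]
  refine (norm_sum_weighted_sum_sq_le (fun p hp => hJ _ (mem_product.1 hp).2) hweight hd u).trans ?_
  rw [Nat.card_Icc, Nat.add_sub_cancel]
  gcongr
  refine (sum_le_sum fun v hv => ?_).trans (sum_correlations_le hY ha X)
  have hy := (mem_product.1 (mem_product.1 hv).1).2
  have hy' := (mem_product.1 (mem_product.1 hv).2).2
  refine norm_sum_mul_conj_le a β γ ?_ (inter_subset_left.trans (hJ _ hy)) v.1 v.2
  rw [coe_inter]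
  exact (hconn _ hy).inter (hconn _ hy')

end Bilinear

section TypeIIEstimate

theorem dyadic_subset {Y : ℝ} : dyadic Y ⊆ Icc 1 ⌊2 * Y⌋₊ := fun y hy => by
  have hy := mem_Ioc.1 hy
  exact mem_Icc.2 ⟨by omega, hy.2⟩

open Classical in
theorem natsUpTo_subset {N Y : ℝ} (hN : 0 ≤ N) (hY : 0 < Y) {y : ℕ} (hy : y ∈ dyadic Y)
    (I : Set ℝ) : natsUpTo (N / y) I ⊆ Icc 1 ⌊N / Y⌋₊ := by
  have hyY : Y ≤ y := ((mem_dyadic hY.le y).1 hy).1.le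
  refine (filter_subset _ _).trans (Icc_subset_Icc_right (Nat.floor_le_floor ?_))
  gcongr

theorem ordConnected_natsUpTo (t : ℝ) {I : Set ℝ} (hI : I.OrdConnected) :
    (natsUpTo t I : Set ℕ).OrdConnected := by
  classical
  rw [natsUpTo, coe_filter]
  simp only [← mem_coe, coe_Icc]
  exact Set.ordConnected_Icc.inter (hI.preimage_mono Nat.mono_cast)

theorem floor_mul_floor_sq_le {U Y : ℝ} (hU : 0 ≤ U) (hY : 0 ≤ Y) :
    ((⌊U⌋₊ * ⌊2 * Y⌋₊ ^ 2 : ℕ) : ℝ) ≤ 4 * (U * Y) * Y := by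
  push_cast
  calc (⌊U⌋₊ : ℝ) * ⌊2 * Y⌋₊ ^ 2 ≤ U * (2 * Y) ^ 2 := by
        gcongr
        · exact Nat.floor_le hU
        · exact Nat.floor_le (by positivity)
    _ = 4 * (U * Y) * Y := by ring

theorem floor_mul_floor_sq_mul_floor_le {N U Y : ℝ} (hN : 0 ≤ N) (hU : 0 ≤ U) (hY : 0 < Y) :
    ((⌊U⌋₊ * ⌊2 * Y⌋₊ ^ 2 : ℕ) : ℝ) * ⌊N / Y⌋₊ ≤ 4 * (U * Y * N) := by
  calc ((⌊U⌋₊ * ⌊2 * Y⌋₊ ^ 2 : ℕ) : ℝ) * ⌊N / Y⌋₊ ≤ 4 * (U * Y) * Y * (N / Y) := by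
        refine mul_le_mul (floor_mul_floor_sq_le hU hY.le) (Nat.floor_le ?_) ?_ ?_ <;> positivity
    _ = 4 * (U * Y * N) := by field_simp

theorem weyl_mean_le {A Z T D q h x l : ℝ} (hA : 0 ≤ A) (hq : 1 ≤ q) (hqZ : q ≤ A * Z)
    (hhx0 : 0 ≤ h * x) (hhx : h * x ≤ 4 * Z) (hxq : x ≤ A * q) (hD0 : 0 ≤ D) (hDT : D ≤ T)
    (hl0 : 0 ≤ l) (hlT : A + 1 + l ≤ T) :
    2 * h * x + 2 * D * (((4 * h * x + 1) / q + 1) * (x + q * (1 + l))) ≤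
      (40 + 4 * A) * T ^ 2 * Z := by
  have hZ : 0 ≤ Z := by linarith
  have hfactor : ((4 * h * x + 1) / q + 1) * (x + q * (1 + l)) ≤ (16 + 2 * A) * Z * T := by
    calc ((4 * h * x + 1) / q + 1) * (x + q * (1 + l))
        ≤ ((4 * (h * x) + 1) / q + 1) * (A * q + q * (1 + l)) := by
          rw [mul_assoc 4 h x]
          gcongr
      _ = (4 * (h * x) + 1 + q) * (A + 1 + l) := by
          field_simp
          ring
      _ ≤ (16 + 2 * A) * Z * T := by
          gcongr
          linarith
  calc 2 * h * x + 2 * D * (((4 * h * x + 1) / q + 1) * (x + q * (1 + l)))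
      ≤ 8 * Z + 2 * D * ((16 + 2 * A) * Z * T) := add_le_add (by linarith) (by gcongr)
    _ ≤ 8 * Z + 2 * T * ((16 + 2 * A) * Z * T) := by
        have hT : 0 ≤ T := hD0.trans hDT
        gcongr
    _ = 8 * Z * 1 + (32 + 4 * A) * T ^ 2 * Z := by ring
    _ ≤ 8 * Z * T ^ 2 + (32 + 4 * A) * T ^ 2 * Z := by
        gcongr
        exact one_le_pow₀ (by linarith)
    _ = (40 + 4 * A) * T ^ 2 * Z := by ring

theorem diagonal_le {N Y U T D x u m : ℝ} (hY : 0 < Y) (hx0 : 0 ≤ x) (hx : x ≤ N / Y)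
    (hu0 : 0 ≤ u) (hu : u ≤ U) (hm0 : 0 ≤ m) (hm : m ≤ 2 * Y) (hD0 : 0 ≤ D) (hDT : D ≤ T)
    (hT : 1 ≤ T) :
    x * (u * m * D * x) ≤ 2 * T ^ 2 * (N ^ 2 * U / Y) := by
  calc x * (u * m * D * x) ≤ N / Y * (U * (2 * Y) * T ^ 2 * (N / Y)) := by
        have hU : 0 ≤ U := hu0.trans hu
        have hNY : 0 ≤ N / Y := hx0.trans hx
        have hDT : D ≤ T ^ 2 := hDT.trans (le_self_pow₀ hT two_ne_zero)
        gcongr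
    _ = 2 * T ^ 2 * (N ^ 2 * U / Y) := by field_simp

theorem off_diagonal_le {N Y U T B E F x : ℝ} (hN : 0 ≤ N) (hY : 0 < Y) (hU : 0 ≤ U)
    (hx : x ≤ N / Y) (hE : E ≤ 8 * U ^ 3 * Y ^ 2 * T ^ 2) (hF : F ≤ B * T ^ 2 * (U * Y * N)) :
    x * (√E * √F) ≤ √(8 * B) * T ^ 2 * (N ^ (3 / 2 : ℝ) * U ^ 2 * √Y) := by
  calc x * (√E * √F)
      ≤ N / Y * (√(8 * U ^ 3 * Y ^ 2 * T ^ 2) * √(B * T ^ 2 * (U * Y * N))) := by gcongr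
    _ = N / Y * √((8 * B) * (T ^ 2 * U ^ 2 * Y) ^ 2 * (Y * N)) := by
        rw [← Real.sqrt_mul (by positivity)]
        ring_nf
    _ = N / Y * (√(8 * B) * (T ^ 2 * U ^ 2 * Y) * (√Y * √N)) := by
        rw [Real.sqrt_mul' _ (by positivity), Real.sqrt_mul' _ (sq_nonneg _),
          Real.sqrt_sq (by positivity), Real.sqrt_mul hY.le]
    _ = √(8 * B) * T ^ 2 * (N ^ (3 / 2 : ℝ) * U ^ 2 * √Y) := by
        rw [show (3 / 2 : ℝ) = 1 + 1 / 2 by norm_num, Real.rpow_add' hN (by norm_num),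
          Real.rpow_one, ← Real.sqrt_eq_rpow]
        field_simp

theorem norm_typeII_sq_le {q : ℕ} [NeZero q] {a : ℤ} (ha : IsCoprime a q) (β γ : ℝ)
    {A N Y U T : ℝ} (hA : 0 ≤ A) (hN : 0 ≤ N) (hY : 0 < Y) (hU : 0 ≤ U) (hNq : N ≤ A * q * Y)
    (hqN : q ≤ A * (U * Y * N)) (hlog : A + 1 + Real.log q ≤ T)
    (hdiv : (maxDivisors (⌊U⌋₊ * ⌊2 * Y⌋₊ ^ 2) : ℝ) ≤ T)
    (hdiv' : (maxDivisors (2 * (⌊U⌋₊ * ⌊2 * Y⌋₊ ^ 2) * ⌊N / Y⌋₊) : ℝ) ≤ T)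
    {I : ℕ → Set ℝ} (hI : ∀ y ∈ dyadic Y, (I y).OrdConnected) {c b d : ℕ → ℂ}
    (hc : ∀ l, ‖c l‖ ≤ 1) (hb : ∀ y, ‖b y‖ ≤ 1) (hd : ∀ x, ‖d x‖ ≤ 1) :
    ‖∑ l ∈ Icc 1 ⌊U⌋₊, c l * ∑ y ∈ dyadic Y, b y *
        ∑ x ∈ natsUpTo (N / y) (I y), d x * e (l * g a q β γ (x * y))‖ ^ 2 ≤
      (2 + √(8 * (40 + 4 * A))) * T ^ 2 * (N ^ 2 * U / Y + N ^ (3 / 2 : ℝ) * U ^ 2 * √Y) := by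
  have hq : (1 : ℝ) ≤ q := Nat.one_le_cast.2 NeZero.one_le
  have hlog0 : 0 ≤ Real.log q := Real.log_nonneg hq
  have hT : 1 ≤ T := by linarith
  have hΛ : (⌊U⌋₊ : ℝ) ≤ U := Nat.floor_le hU
  have hM : (⌊2 * Y⌋₊ : ℝ) ≤ 2 * Y := Nat.floor_le (by positivity)
  have hX : (⌊N / Y⌋₊ : ℝ) ≤ N / Y := Nat.floor_le (by positivity)
  have henergy : 2 * (⌊U⌋₊ : ℝ) ^ 3 * ⌊2 * Y⌋₊ ^ 2 *
      maxDivisors (⌊U⌋₊ * ⌊2 * Y⌋₊ ^ 2) ^ 2 ≤ 8 * U ^ 3 * Y ^ 2 * T ^ 2 := by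
    calc _ ≤ 2 * U ^ 3 * (2 * Y) ^ 2 * T ^ 2 := by gcongr
      _ = 8 * U ^ 3 * Y ^ 2 * T ^ 2 := by ring
  have hmean := weyl_mean_le hA hq hqN (by positivity)
    (floor_mul_floor_sq_mul_floor_le hN hU hY)
    (hX.trans ((div_le_iff₀ hY).2 hNq)) (Nat.cast_nonneg _) hdiv' hlog0 hlog
  refine (norm_bilinear_sq_le dyadic_subset (fun y hy => natsUpTo_subset hN hY hy (I y))
    (fun y hy => ordConnected_natsUpTo _ (hI y hy)) ha β γ hc hb hd).trans ?_
  rw [mul_add]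
  refine (add_le_add (diagonal_le hY (Nat.cast_nonneg _) hX (Nat.cast_nonneg _) hΛ
    (Nat.cast_nonneg _) hM (Nat.cast_nonneg _) hdiv hT)
    (off_diagonal_le hN hY hU hX henergy hmean)).trans ?_
  rw [add_mul, add_mul]
  gcongr
  · exact le_add_of_nonneg_right (by positivity)
  · exact le_add_of_nonneg_left (by positivity)

theorem exists_maxDivisors_le_of_le (A : ℝ) {B δ : ℝ} (hA : 0 ≤ A) (hB : 0 ≤ B) (hδ : 0 < δ) :
    ∃ C, ∀ N : ℝ, 1 ≤ N → ∀ n : ℕ, (n : ℝ) ≤ B * N ^ 2 →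
      (maxDivisors n : ℝ) ≤ C * N ^ δ ∧ A + Real.log n ≤ C * N ^ δ := by
  obtain ⟨C, hC, hdiv⟩ := exists_maxDivisors_le (half_pos hδ)
  refine ⟨C * B ^ (δ / 2) + (A + B ^ (δ / 2) / (δ / 2)), fun N hN n hn => ?_⟩
  have hN0 : 0 < N := by linarith
  have hNδ : 1 ≤ N ^ δ := Real.one_le_rpow hN hδ.le
  have hpow : (n : ℝ) ^ (δ / 2) ≤ B ^ (δ / 2) * N ^ δ := by
    calc (n : ℝ) ^ (δ / 2) ≤ (B * N ^ 2) ^ (δ / 2) := by gcongr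
      _ = B ^ (δ / 2) * N ^ δ := by
        rw [Real.mul_rpow hB (by positivity), ← Real.rpow_natCast, ← Real.rpow_mul hN0.le,
          Nat.cast_two, mul_div_cancel₀ δ two_ne_zero]
  constructor
  · calc (maxDivisors n : ℝ) ≤ C * (B ^ (δ / 2) * N ^ δ) := (hdiv n).trans (by gcongr)
      _ ≤ _ := by
        rw [← mul_assoc]
        gcongr
        exact le_add_of_nonneg_right (by positivity)
  · calc A + Real.log n ≤ A * N ^ δ + B ^ (δ / 2) * N ^ δ / (δ / 2) := by
          refine add_le_add (le_mul_of_one_le_right hA hNδ) ?_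
          exact (Real.log_le_rpow_div n.cast_nonneg (half_pos hδ)).trans (by gcongr)
      _ = (A + B ^ (δ / 2) / (δ / 2)) * N ^ δ := by ring
      _ ≤ _ := by
          refine mul_le_mul_of_nonneg_right ?_ (by positivity)
          exact le_add_of_nonneg_left (by positivity)

theorem exists_norm_typeII_sq_le {A δ : ℝ} (hA : 0 < A) (hδ : 0 < δ) :
    ∃ K, 0 ≤ K ∧ ∀ (a : ℤ) (q : ℕ) (β γ N Y U : ℝ), 0 < q → IsCoprime a q → 1 ≤ N → 0 < Y →
      0 ≤ U → Y ≤ A * N → U * Y ≤ A * N → N ≤ A * q * Y → q ≤ A * (U * Y * N) →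
      ∀ I : ℕ → Set ℝ, (∀ y ∈ dyadic Y, (I y).OrdConnected) →
      ∀ c b d : ℕ → ℂ, (∀ l, ‖c l‖ ≤ 1) → (∀ y, ‖b y‖ ≤ 1) → (∀ x, ‖d x‖ ≤ 1) →
        ‖∑ l ∈ Icc 1 ⌊U⌋₊, c l * ∑ y ∈ dyadic Y, b y *
            ∑ x ∈ natsUpTo (N / y) (I y), d x * e (l * g a q β γ (x * y))‖ ^ 2 ≤
          K * N ^ δ * (N ^ 2 * U / Y + N ^ (3 / 2 : ℝ) * U ^ 2 * √Y) := by
  obtain ⟨C, hC⟩ := exists_maxDivisors_le_of_le (A + 1) (B := 5 * A ^ 2 + 8 * A)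
    (by positivity) (by positivity) (half_pos hδ)
  refine ⟨(2 + √(8 * (40 + 4 * A))) * C ^ 2, by positivity, ?_⟩
  intro a q β γ N Y U hq ha hN hY hU hYN hUY hNq hqN I hI c b d hc hb hd
  have : NeZero q := ⟨hq.ne'⟩
  have hN0 : 0 < N := by linarith
  have hqN2 : (q : ℝ) ≤ A ^ 2 * N ^ 2 := by
    calc (q : ℝ) ≤ A * (A * N * N) := hqN.trans (by gcongr)
      _ = A ^ 2 * N ^ 2 := by ring
  have hΛM : ((⌊U⌋₊ * ⌊2 * Y⌋₊ ^ 2 : ℕ) : ℝ) ≤ 4 * A ^ 2 * N ^ 2 := by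
    calc _ ≤ 4 * (A * N) * (A * N) := (floor_mul_floor_sq_le hU hY.le).trans (by gcongr)
      _ = 4 * A ^ 2 * N ^ 2 := by ring
  have hΛMX : ((2 * (⌊U⌋₊ * ⌊2 * Y⌋₊ ^ 2) * ⌊N / Y⌋₊ : ℕ) : ℝ) ≤ 8 * A * N ^ 2 := by
    rw [mul_assoc, Nat.cast_mul, Nat.cast_mul _ ⌊N / Y⌋₊, Nat.cast_two]
    calc _ ≤ 2 * (4 * (U * Y * N)) :=
          mul_le_mul_of_nonneg_left (floor_mul_floor_sq_mul_floor_le hN0.le hU hY) zero_le_two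
      _ ≤ 2 * (4 * (A * N * N)) := by gcongr
      _ = 8 * A * N ^ 2 := by ring
  have hconst : A ^ 2 * N ^ 2 ≤ (5 * A ^ 2 + 8 * A) * N ^ 2 ∧
      4 * A ^ 2 * N ^ 2 ≤ (5 * A ^ 2 + 8 * A) * N ^ 2 ∧
      8 * A * N ^ 2 ≤ (5 * A ^ 2 + 8 * A) * N ^ 2 := by
    refine ⟨?_, ?_, ?_⟩ <;> gcongr <;> linarith [sq_nonneg A]
  have hbound := norm_typeII_sq_le ha β γ hA.le hN0.le hY hU hNq hqN
    (hC N hN _ (hqN2.trans hconst.1)).2 (hC N hN _ (hΛM.trans hconst.2.1)).1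
    (hC N hN _ (hΛMX.trans hconst.2.2)).1 hI hc hb hd
  refine hbound.trans_eq ?_
  rw [mul_pow, ← Real.rpow_natCast (N ^ (δ / 2)), ← Real.rpow_mul hN0.le, Nat.cast_two,
    div_mul_cancel₀ δ two_ne_zero]
  ring

end TypeIIEstimate

section Exponents

variable {ρ ε N A B Y : ℝ}

theorem sq_mul_rpow_div_le (hN : 0 < N) (hY : 0 < Y) (hYA : N ^ ρ ≤ A * Y) :
    N ^ 2 * N ^ (ρ - ε / 3) / Y ≤ A * N ^ (2 - ε / 3) := by
  calc N ^ 2 * N ^ (ρ - ε / 3) / Y = N ^ (2 - ε / 3) * N ^ ρ / Y := by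
        rw [← Real.rpow_two, ← Real.rpow_add hN, ← Real.rpow_add hN]
        ring_nf
    _ ≤ N ^ (2 - ε / 3) * (A * Y) / Y := by gcongr
    _ = A * N ^ (2 - ε / 3) := by field_simp

theorem rpow_mul_sq_mul_sqrt_le (hN : 1 ≤ N) (hε : 0 ≤ ε) (hYA : Y ≤ A * N ^ (1 - 4 * ρ)) :
    N ^ (3 / 2 : ℝ) * (N ^ (ρ - ε / 3)) ^ 2 * √Y ≤ √A * N ^ (2 - ε / 3) := by
  have hN0 : 0 < N := by linarith
  calc N ^ (3 / 2 : ℝ) * (N ^ (ρ - ε / 3)) ^ 2 * √Y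
      ≤ N ^ (3 / 2 : ℝ) * (N ^ (ρ - ε / 3)) ^ 2 * √(A * N ^ (1 - 4 * ρ)) := by gcongr
    _ = √A * N ^ (3 / 2 + (ρ - ε / 3) * 2 + (1 - 4 * ρ) * (1 / 2)) := by
        rw [Real.sqrt_mul' _ (by positivity), Real.sqrt_eq_rpow (N ^ _), ← Real.rpow_mul hN0.le,
          ← Real.rpow_natCast, ← Real.rpow_mul hN0.le, Nat.cast_two, Real.rpow_add hN0,
          Real.rpow_add hN0]
        ring
    _ ≤ √A * N ^ (2 - ε / 3) := by
        gcongr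
        linarith

theorem rpow_le_L₁_rpow_half_mul (hN : 1 ≤ N) (hρ : ε / 6 ≤ ρ) :
    N ^ (1 - ρ) ≤ L₁ ρ ε N ^ (1 / 2 : ℝ) * N := by
  have hN0 : 0 < N := by linarith
  have hL₁ : N ^ (ρ - ε / 2) ≤ L₁ ρ ε N := le_mul_of_one_le_left (by positivity) one_le_two
  calc N ^ (1 - ρ) ≤ N ^ ((ρ - ε / 2) * (1 / 2) + 1) := by
        gcongr
        linarith
    _ = (N ^ (ρ - ε / 2)) ^ (1 / 2 : ℝ) * N := by
        rw [Real.rpow_add hN0, Real.rpow_mul hN0.le, Real.rpow_one]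
    _ ≤ L₁ ρ ε N ^ (1 / 2 : ℝ) * N := by gcongr

theorem L₁_rpow_half_mul_le (hN : 1 ≤ N) (hρ : ε / 18 ≤ ρ) :
    L₁ ρ ε N ^ (1 / 2 : ℝ) * N ≤ 2 * N ^ (1 + 2 * ρ - ε / 3) := by
  have hN0 : 0 < N := by linarith
  have hsqrt : (2 : ℝ) ^ (1 / 2 : ℝ) ≤ 2 := Real.rpow_le_self_of_one_le one_le_two (by norm_num)
  calc L₁ ρ ε N ^ (1 / 2 : ℝ) * N = 2 ^ (1 / 2 : ℝ) * N ^ ((ρ - ε / 2) * (1 / 2) + 1) := by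
        rw [L₁, Real.mul_rpow zero_le_two (by positivity), Real.rpow_add hN0,
          Real.rpow_mul hN0.le, Real.rpow_one, mul_assoc]
    _ ≤ 2 * N ^ (1 + 2 * ρ - ε / 3) := by
        gcongr
        linarith

theorem le_mul_self_of_le_mul_rpow (hA : 0 ≤ A) (hN : 1 ≤ N) (hρ : 0 ≤ ρ)
    (hYA : Y ≤ A * N ^ (1 - 4 * ρ)) : Y ≤ A * N := by
  calc Y ≤ A * N ^ (1 : ℝ) := hYA.trans (by gcongr; linarith)
    _ = A * N := by rw [Real.rpow_one]

theorem rpow_mul_le_mul_self (hA : 0 ≤ A) (hN : 1 ≤ N) (hε : 0 ≤ ε) (hρ : 0 ≤ ρ)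
    (hYA : Y ≤ A * N ^ (1 - 4 * ρ)) : N ^ (ρ - ε / 3) * Y ≤ A * N := by
  have hN0 : 0 < N := by linarith
  calc N ^ (ρ - ε / 3) * Y ≤ N ^ (ρ - ε / 3) * (A * N ^ (1 - 4 * ρ)) := by gcongr
    _ = A * N ^ (ρ - ε / 3 + (1 - 4 * ρ)) := by rw [Real.rpow_add hN0]; ring
    _ ≤ A * N ^ (1 : ℝ) := by gcongr; linarith
    _ = A * N := by rw [Real.rpow_one]

theorem le_sq_mul_mul_of_rpow_le {q : ℝ} (hA : 0 ≤ A) (hN : 0 < N) (hq : 0 ≤ q)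
    (hqA : N ^ (1 - ρ) ≤ A * q) (hYA : N ^ ρ ≤ A * Y) : N ≤ A ^ 2 * q * Y := by
  calc N = N ^ (1 - ρ) * N ^ ρ := by rw [← Real.rpow_add hN, sub_add_cancel, Real.rpow_one]
    _ ≤ A * q * (A * Y) := by gcongr
    _ = A ^ 2 * q * Y := by ring

theorem le_mul_mul_rpow_mul_mul {q : ℝ} (hB : 0 ≤ B) (hN : 0 < N)
    (hqB : q ≤ B * N ^ (1 + 2 * ρ - ε / 3)) (hYA : N ^ ρ ≤ A * Y) :
    q ≤ A * B * (N ^ (ρ - ε / 3) * Y * N) := by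
  calc q ≤ B * N ^ (ρ + (ρ - ε / 3) + 1) := hqB.trans_eq (by ring_nf)
    _ = B * (N ^ ρ * N ^ (ρ - ε / 3) * N) := by
        rw [Real.rpow_add hN, Real.rpow_add hN, Real.rpow_one]
    _ ≤ B * (A * Y * N ^ (ρ - ε / 3) * N) := by gcongr
    _ = A * B * (N ^ (ρ - ε / 3) * Y * N) := by ring

theorem ten_mul_pow_nine_lt (hε : 0 < ε) (hε' : ε < 1 / 2) : 10 * ε ^ 9 < ε / 6 := by
  have hpow : ε ^ 8 < (1 / 2) ^ 8 := by gcongr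
  calc 10 * ε ^ 9 = ε * (10 * ε ^ 8) := by ring
    _ < ε * (10 * (1 / 2) ^ 8) := by gcongr
    _ < ε / 6 := by linarith

end Exponents

end TypeII

theorem theorem3_general {ε η A B : ℝ} (hε : 0 < ε) (hη : η < ε / 6) (hA : 0 < A)
    (hB : 0 ≤ B) :
    ∃ K : ℝ, ∀ (ρ : ℝ), 0 ≤ ρ →
      ∀ (a : ℤ) (q : ℕ) (β γ N Y : ℝ), 0 < q → IsCoprime a (q : ℤ) → 1 ≤ N →
        N ^ (1 - ρ) ≤ A * q → q ≤ B * N ^ (1 + 2 * ρ - ε / 3) →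
        N ^ ρ ≤ A * Y → Y ≤ A * N ^ (1 - 4 * ρ) →
        ∀ (I : ℕ → Set ℝ), (∀ y ∈ TypeII.dyadic Y, (I y).OrdConnected) →
        ∀ (c b d : ℕ → ℂ), (∀ ℓ, ‖c ℓ‖ ≤ 1) → (∀ y, ‖b y‖ ≤ 1) → (∀ x, ‖d x‖ ≤ 1) →
          ‖TypeII.bilinearSum ρ ε N Y (TypeII.g a q β γ) I c b d‖ ≤ K * N ^ (1 - η) := by
  obtain ⟨K, hK, htypeII⟩ := TypeII.exists_norm_typeII_sq_le (A := A + A ^ 2 + A * B)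
    (by positivity) (by linarith : 0 < ε / 3 - 2 * η)
  refine ⟨√(K * (A + √A)), ?_⟩
  intro ρ hρ a q β γ N Y hq ha hN hNq hqN hNY hYN I hI c b d hc hb hd
  have hN0 : 0 < N := by linarith
  have hY : 0 < Y := pos_of_mul_pos_right ((by positivity : 0 < N ^ ρ).trans_le hNY) hA.le
  have hA₁ : A ≤ A + A ^ 2 + A * B := by linarith [mul_nonneg hA.le hB, sq_nonneg A]
  have hA₂ : A ^ 2 ≤ A + A ^ 2 + A * B := by linarith [mul_nonneg hA.le hB]
  have hAB : A * B ≤ A + A ^ 2 + A * B := le_add_of_nonneg_left (by positivity)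
  have hbound := htypeII a q β γ N Y (N ^ (ρ - ε / 3)) hq ha hN hY (by positivity)
    ((TypeII.le_mul_self_of_le_mul_rpow hA.le hN hρ hYN).trans (by gcongr))
    ((TypeII.rpow_mul_le_mul_self hA.le hN hε.le hρ hYN).trans (by gcongr))
    ((TypeII.le_sq_mul_mul_of_rpow_le hA.le hN0 q.cast_nonneg hNq hNY).trans (by gcongr))
    ((TypeII.le_mul_mul_rpow_mul_mul hB hN0 hqN hNY).trans (by gcongr))
    I hI c b d hc hb hd
  refine le_of_sq_le_sq ?_ (by positivity)
  calc _ ≤ K * N ^ (ε / 3 - 2 * η) * (N ^ 2 * N ^ (ρ - ε / 3) / Y +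
        N ^ (3 / 2 : ℝ) * (N ^ (ρ - ε / 3)) ^ 2 * √Y) := hbound
    _ ≤ K * N ^ (ε / 3 - 2 * η) * (A * N ^ (2 - ε / 3) + √A * N ^ (2 - ε / 3)) := by
        refine mul_le_mul_of_nonneg_left (add_le_add ?_ ?_) (by positivity)
        · exact TypeII.sq_mul_rpow_div_le hN0 hY hNY
        · exact TypeII.rpow_mul_sq_mul_sqrt_le hN hε.le hYN
    _ = K * (A + √A) * N ^ (ε / 3 - 2 * η + (2 - ε / 3)) := by rw [Real.rpow_add hN0]; ring
    _ = (√(K * (A + √A)) * N ^ (1 - η)) ^ 2 := by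
        rw [mul_pow, Real.sq_sqrt (by positivity), ← Real.rpow_natCast (N ^ _),
          ← Real.rpow_mul hN0.le]
        push_cast
        ring_nf

theorem theorem3 :
    ∃ ε₀ : ℝ, 0 < ε₀ ∧ ∀ ε : ℝ, 0 < ε → ε < ε₀ → ∀ A : ℝ, 0 < A →
      ∃ K : ℝ, ∀ (ρ : ℝ), 1 / 6 < ρ → ρ < 1 / 5 →
        ∀ (a : ℤ) (q : ℕ) (β γ N Y : ℝ), 0 < q → IsCoprime a (q : ℤ) → 1 ≤ N →
          (TypeII.L₁ ρ ε N) ^ (1 / 2 : ℝ) * N ≤ A * q →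
          (q : ℝ) ≤ A * ((TypeII.L₁ ρ ε N) ^ (1 / 2 : ℝ) * N) →
          N ^ ρ ≤ A * Y → Y ≤ A * N ^ (1 - 4 * ρ) →
          ∀ (I : ℕ → Set ℝ), (∀ y ∈ TypeII.dyadic Y, TypeII.IsSubinterval N y (I y)) →
          ∀ (c b d : ℕ → ℂ), (∀ ℓ, ‖c ℓ‖ ≤ 1) → (∀ y, ‖b y‖ ≤ 1) → (∀ x, ‖d x‖ ≤ 1) →
            ‖TypeII.bilinearSum ρ ε N Y (TypeII.g a q β γ) I c b d‖
              ≤ K * N ^ (1 - 10 * ε ^ 9) := by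
  refine ⟨1 / 2, by norm_num, fun ε hε hε' A hA => ?_⟩
  obtain ⟨K, hK⟩ := theorem3_general (B := A * 2) hε (TypeII.ten_mul_pow_nine_lt hε hε') hA
    (by positivity)
  refine ⟨K, fun ρ hρ _ a q β γ N Y hq ha hN hNq hqN hNY hYN I hI => ?_⟩
  refine hK ρ (by linarith) a q β γ N Y hq ha hN ?_ ?_ hNY hYN I fun y hy => (hI y hy).1
  · exact (TypeII.rpow_le_L₁_rpow_half_mul hN (by linarith)).trans hNq
  · rw [mul_assoc]
    exact hqN.trans
      (mul_le_mul_of_nonneg_left (TypeII.L₁_rpow_half_mul_le hN (by linarith)) hA.le)
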